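/- Fix a finite set of unitary quantum gates. For every security parameter $\kappa\in\mathbb N$ let $\mathcal H_\kappa=\mathbb C^{d(\kappa)}$, $d(\kappa)\ge 1$, be a Hilbert space (stored in $\lceil\log_2 d(\kappa)\rceil$ qubits, with $|i\rangle$ for the $i$-th basis vector), and let $\mathcal K_\kappa$ be a finite non-empty set of keys (bit strings). For a closed subgroup $H\le\mathbb U(\mathcal H_\kappa)$ let $\mathbb U(\mathcal H_\kappa)/H$ be the quotient in which $g_1,g_2$ are identified when $g_1=hg_2$ for some $h\in H$, and let $\mu_H$ be its Haar measure, i.e. the Borel probability measure that is invariant under the action of $\mathbb U(\mathcal H_\kappa)$. A representative map $\tau$ assigns to every class $x\in\mathbb U(\mathcal H_\kappa)/H$, possibly probabilistically (as a Markov kernel), an element of $x$; $\nu(\tau)$ denotes the law on $\mathbb U(\mathcal H_\kappa)$ obtained by sampling $x$ from $\mu_H$ and then applying $\tau$. An efficient quantum algorithm is a family of quantum circuits over the gate set, with ancillas in state $|0\rangle$ and possibly with oracle queries, whose descriptions are computed by one Turing machine from $1^\kappa$ (and the key, if a key is given) in time polynomial in $\kappa$. In particular it makes at most polynomially many queries.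 A function $f$ is negligible if $\kappa^c f(\kappa)\to 0$ for every $c\in\mathbb N$. Let $H=(H_\kappa)_\kappa$ be a family of closed subgroups $H_\kappa\le\mathbb U(\mathcal H_\kappa)$. * A family of unitary operators $(U_k)_{k\in\mathcal K_\kappa}$, $U_k\in\mathbb U(\mathcal H_\kappa)$ (as representatives of their classes in $\mathbb U(\mathcal H_\kappa)/H_\kappa$), is an HPRU for $\mathbb U/H$ if (1) there is an efficient quantum algorithm $Q$ with $Q(k,|\psi\rangle)=U_k|\psi\rangle$ for all $k\in\mathcal K_\kappa$ and all pure states $|\psi\rangle\in\mathcal H_\kappa$; and (2) there are representative maps $\tau_\kappa$ such that, with $\nu_\kappa=\nu(\tau_\kappa)$, for every efficient quantum oracle algorithm $A$ the function $$\kappa\mapsto\left|\Pr_{k\leftarrow\mathcal K_\kappa}[A^{U_k}(1^\kappa)=1]-\Pr_{U\leftarrow\nu_\kappa}[A^{U}(1^\kappa)=1]\right|$$ is negligible, where $k$ is uniformly distributed on $\mathcal K_\kappa$. * A family of pure states $(|\phi_k\rangle)_{k\in\mathcal K_\kappa}$ in $\mathcal H_\kappa$ is an HPRS for $\mathbb U/H$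 if (1) there is an efficient quantum algorithm $G$ with $G(k)=|\phi_k\rangle$ for all $k\in\mathcal K_\kappa$; and (2) there are representative maps $\tau_\kappa$ such that, with $\nu_\kappa=\nu(\tau_\kappa)$, for every efficient quantum algorithm $A$ and every polynomially bounded $m:\mathbb N\to\mathbb N$ the function $$\kappa\mapsto\left|\Pr_{k\leftarrow\mathcal K_\kappa}[A(|\phi_k\rangle^{\otimes m(\kappa)})=1]-\Pr_{U\leftarrow\nu_\kappa}[A((U|0\rangle)^{\otimes m(\kappa)})=1]\right|$$ is negligible. Claim: let $H_1=(H_{1,\kappa})_\kappa$ and $H_2=(H_{2,\kappa})_\kappa$ be families of closed subgroups with $H_{1,\kappa}\le H_{2,\kappa}\le\mathbb U(\mathcal H_\kappa)$ for all $\kappa$. Then every HPRU for $\mathbb U/H_1$ is an HPRU for $\mathbb U/H_2$, and every HPRS for $\mathbb U/H_1$ is an HPRS for $\mathbb U/H_2$. -/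

import Mathlib

noncomputable section

open MeasureTheory ProbabilityTheory Filter

namespace HomPR

/-! ### Homogeneous spaces and their Haar measure -/

section Homogeneous

variable {G : Type*} [Group G]

/-- The homogeneous space `G/H`: the quotient of `G` by left multiplication by elements of `H`,
so that `g₁` and `g₂` are identified when `g₁ = h g₂` for some `h ∈ H`. -/
def CosetSpace (H : Subgroup G) : Type _ := Quotient (QuotientGroup.rightRel H)

namespace CosetSpace

/-- The canonical projection `G → G/H`. -/
def mk (H : Subgroup G) (g : G) : CosetSpace H := Quotient.mk (QuotientGroup.rightRel H) g

theorem mk_eq_iff {H : Subgroup G} {g₁ g₂ : G} : mk H g₁ = mk H g₂ ↔ ∃ h ∈ H, g₁ = h * g₂ := by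
  have key : mk H g₁ = mk H g₂ ↔ g₂ * g₁⁻¹ ∈ H :=
    (Quotient.eq (r := QuotientGroup.rightRel H)).trans QuotientGroup.rightRel_apply
  rw [key]
  constructor
  · intro h
    exact ⟨g₁ * g₂⁻¹, by simpa using H.inv_mem h, by simp⟩
  · rintro ⟨h, hh, rfl⟩
    simpa using hh

/-- The action of `g ∈ G` on `G/H`, sending the class of `x` to the class of `x g`. -/
def translate (H : Subgroup G) (g : G) : CosetSpace H → CosetSpace H :=
  Quotient.map (fun x => x * g) (by
    intro a b hab
    have h : QuotientGroup.rightRel H a b := hab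
    rw [QuotientGroup.rightRel_apply] at h
    change QuotientGroup.rightRel H (a * g) (b * g)
    rw [QuotientGroup.rightRel_apply]
    simpa [mul_assoc] using h)

/-- The quotient topology on `G/H`. -/
instance instTopologicalSpace (H : Subgroup G) [TopologicalSpace G] :
    TopologicalSpace (CosetSpace H) :=
  inferInstanceAs (TopologicalSpace (Quotient (QuotientGroup.rightRel H)))

/-- The Borel σ-algebra of the quotient topology on `G/H`. -/
instance instMeasurableSpace (H : Subgroup G) [TopologicalSpace G] :
    MeasurableSpace (CosetSpace H) := borel _

instance instBorelSpace (H : Subgroup G) [TopologicalSpace G] : BorelSpace (CosetSpace H) := ⟨rfl⟩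

end CosetSpace

variable [TopologicalSpace G]

/-- `μ` is the (normalized) Haar measure on `G/H`: the `G`-invariant Borel probability measure. -/
structure IsHaarProb (H : Subgroup G) (μ : Measure (CosetSpace H)) : Prop where
  isProbabilityMeasure : IsProbabilityMeasure μ
  map_translate : ∀ g : G, μ.map (CosetSpace.translate H g) = μ

/-- `τ` is a (possibly probabilistic) map that assigns to every class `x ∈ G/H` a representative of
`x`: a Markov kernel such that a sample from `τ x` lies in the class `x` almost surely. -/
structure IsRepresentativeMap [MeasurableSpace G] (H : Subgroup G)
    (τ : Kernel (CosetSpace H) G) : Prop where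
  isMarkovKernel : IsMarkovKernel τ
  mem_class : ∀ x : CosetSpace H, ∀ᵐ g ∂(τ x), CosetSpace.mk H g = x

/-- `ν = ν(τ)` is the law of a group element that is obtained by sampling a class from the Haar
measure on `G/H` and then choosing a representative of it with some map `τ`. -/
def IsHaarSampling [MeasurableSpace G] (H : Subgroup G) (ν : Measure G) : Prop :=
  ∃ (μ : Measure (CosetSpace H)) (τ : Kernel (CosetSpace H) G),
    IsHaarProb H μ ∧ IsRepresentativeMap H τ ∧ ν = μ.bind τ

end Homogeneous

/-- The unitary group of the Hilbert space `ℂ^d`. -/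
abbrev UGroup (d : ℕ) : Type := Matrix.unitaryGroup (Fin d) ℂ

instance instMeasurableSpaceUGroup (d : ℕ) : MeasurableSpace (UGroup d) := borel _

instance instBorelSpaceUGroup (d : ℕ) : BorelSpace (UGroup d) := ⟨rfl⟩

/-! ### Quantum circuits with oracle queries -/

/-- A computational basis state of `n` qubits. -/
abbrev QIdx (n : ℕ) : Type := Fin n → Fin 2

/-- The vector of amplitudes of a state of `n` qubits. -/
abbrev QVec (n : ℕ) : Type := QIdx n → ℂ

/-- A finite gate set: finitely many unitary gates, each acting on a fixed number of qubits. -/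
structure GateSet where
  /-- the number of gates -/
  num : ℕ
  /-- the number of qubits on which a gate acts -/
  arity : Fin num → ℕ
  /-- the unitary matrix of a gate -/
  mat : ∀ i, Matrix.unitaryGroup (QIdx (arity i)) ℂ

/-- One instruction of a circuit: a gate, or a query to the oracle, applied to a list of wires. -/
inductive Instr (𝒢 : GateSet) : Type
  | gate (i : Fin 𝒢.num) (wires : List ℕ) : Instr 𝒢
  | query (wires : List ℕ) : Instr 𝒢

/-- A circuit: a number of ancilla qubits (which follow the input qubits and start in `|0⟩`), a list
of instructions, and the list of wires that hold the output. -/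
structure Circuit (𝒢 : GateSet) where
  /-- the number of ancilla qubits -/
  ancillas : ℕ
  /-- the instructions, in the order in which they are executed -/
  instrs : List (Instr 𝒢)
  /-- the output wires -/
  outs : List ℕ

section Encoding

variable {𝒢 : GateSet}

/-- Unary, self-delimiting encoding of a natural number. -/
def encNat (n : ℕ) : List Bool := List.replicate n true ++ [false]

/-- Self-delimiting encoding of a list of natural numbers. -/
def encList (l : List ℕ) : List Bool := encNat l.length ++ l.flatMap encNat

/-- Encoding of an instruction; opcode `0` is an oracle query, opcode `i + 1` is gate `i`. -/
def Instr.encode : Instr 𝒢 → List Bool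
  | .gate i ws => encNat (i + 1) ++ encList ws
  | .query ws => encNat 0 ++ encList ws

/-- Encoding of a circuit as a bit string. -/
def Circuit.encode (C : Circuit 𝒢) : List Bool :=
  encNat C.ancillas ++ encNat C.instrs.length ++ C.instrs.flatMap Instr.encode ++ encList C.outs

end Encoding

/-- The linear map that applies the `s`-qubit matrix `M` to the distinct wires `w 0, …, w (s-1)` of
an `N`-qubit register, and the identity to the other wires. -/
def applyOn {N s : ℕ} (M : Matrix (QIdx s) (QIdx s) ℂ) (w : Fin s → Fin N) (ψ : QVec N) : QVec N :=
  fun b => ∑ c : QIdx s, M (b ∘ w) c * ψ (Function.extend w c b)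

/-- Applies `M` to a list of wires; an instruction whose list is not a list of `s` distinct wires of
the register has no effect. -/
def applyAt {N s : ℕ} (M : Matrix (QIdx s) (QIdx s) ℂ) (ws : List ℕ) (ψ : QVec N) : QVec N :=
  if h : ws.Nodup ∧ ws.length = s ∧ ∀ x ∈ ws, x < N then
    applyOn M (fun i => ⟨ws.get (i.cast h.2.1.symm), h.2.2 _ (List.get_mem _ _)⟩) ψ
  else ψ

section Run

variable {𝒢 : GateSet} {q N : ℕ}

/-- The effect of one instruction, with the `q`-qubit oracle `O`. -/
def Instr.apply (O : Matrix (QIdx q) (QIdx q) ℂ) : Instr 𝒢 → QVec N → QVec N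
  | .gate i ws, ψ => applyAt (𝒢.mat i).1 ws ψ
  | .query ws, ψ => applyAt O ws ψ

/-- The final state of the circuit `C` with oracle `O`, started with the `s`-qubit state `χ` in the
input wires `0, …, s-1` and with `|0⟩` in every ancilla wire. -/
def Circuit.run (C : Circuit 𝒢) (O : Matrix (QIdx q) (QIdx q) ℂ) {s : ℕ} (χ : QVec s) :
    QVec (s + C.ancillas) :=
  C.instrs.foldl (fun ψ I => I.apply O ψ)
    (fun b => if ∀ j, b (Fin.natAdd s j) = 0 then χ (fun i => b (Fin.castAdd C.ancillas i)) else 0)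

open Classical in
/-- The probability that measuring the (first) output wire of the final state gives `1`. -/
def Circuit.acceptProb (C : Circuit 𝒢) (O : Matrix (QIdx q) (QIdx q) ℂ) {s : ℕ} (χ : QVec s) : ℝ :=
  ∑ b : QIdx (s + C.ancillas),
    if ∃ w : Fin (s + C.ancillas), C.outs.head? = some (w : ℕ) ∧ b w = 1 then
      ‖C.run O χ b‖ ^ 2
    else 0

/-- Without oracle queries, `C` turns the input state `χ` into the pure state `φ` of its output
wires: the final state is the product of `φ` and some state `g` of the remaining wires. -/
def Circuit.Outputs (C : Circuit 𝒢) {s t : ℕ} (χ : QVec s) (φ : QVec t) : Prop :=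
  ∃ w : Fin t → Fin (s + C.ancillas), Function.Injective w ∧
    C.outs = List.ofFn (fun i => (w i : ℕ)) ∧
    ∃ g : QVec (s + C.ancillas),
      (∀ b b', (∀ j, j ∉ Set.range w → b j = b' j) → g b = g b') ∧
      ∀ b, C.run (1 : Matrix (QIdx 0) (QIdx 0) ℂ) χ b = φ (b ∘ w) * g b

end Run

/-! ### Hilbert spaces as registers of qubits -/

/-- The number of qubits of a register that holds `ℂ^d`. -/
def numQubits (d : ℕ) : ℕ := Nat.clog 2 d

/-- The number that a computational basis state stands for. -/
def QIdx.val {n : ℕ} (b : QIdx n) : ℕ := (finFunctionFinEquiv b : Fin (2 ^ n))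

/-- A vector of `ℂ^d` as a state of a register: the basis vector `e_i` becomes the computational
basis state `|i⟩`. -/
def embedVec {d : ℕ} (v : EuclideanSpace ℂ (Fin d)) : QVec (numQubits d) :=
  fun b => if h : b.val < d then v ⟨b.val, h⟩ else 0

/-- A unitary operator on `ℂ^d` as an operator on a register: it acts on the span of
`|0⟩, …, |d-1⟩` and is extended by the identity on the other computational basis states. -/
def embedOp {d : ℕ} (U : UGroup d) : Matrix (QIdx (numQubits d)) (QIdx (numQubits d)) ℂ :=
  fun b c =>
    if hb : b.val < d then
      if hc : c.val < d then (U : Matrix (Fin d) (Fin d) ℂ) ⟨b.val, hb⟩ ⟨c.val, hc⟩ else 0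
    else if b = c then 1 else 0

/-- The state `φ^{⊗ m}` of `m` registers of `n` qubits. -/
def copies {n : ℕ} (m : ℕ) (φ : QVec n) : QVec (m * n) :=
  fun b => ∏ i : Fin m, φ (fun j => b (finProdFinEquiv (i, j)))

/-- `U|ψ⟩`. -/
def applyU {d : ℕ} (U : UGroup d) (ψ : EuclideanSpace ℂ (Fin d)) : EuclideanSpace ℂ (Fin d) :=
  WithLp.toLp 2 ((U : Matrix (Fin d) (Fin d) ℂ).mulVec ψ.ofLp)

/-- The state `|0⟩` of `ℂ^d`. -/
def ket0 (d : ℕ) [NeZero d] : EuclideanSpace ℂ (Fin d) := EuclideanSpace.single 0 1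

/-! ### Efficient quantum algorithms -/

/-- A single Turing machine computes, for all `i`, the bit string `out i` from the bit string
`inp i`, within a number of steps that is polynomial in the security parameter `κ i`. -/
def PolyTime {ι : Type} (κ : ι → ℕ) (inp out : ι → List Bool) : Prop :=
  ∃ (M : Turing.TM2ComputableAux Bool Bool) (p : Polynomial ℕ),
    (∀ k, Finite (M.tm.Γ k)) ∧
    ∀ i, Nonempty (Turing.TM2OutputsInTime M.tm ((inp i).map M.inputAlphabet.symm)
      (some ((out i).map M.outputAlphabet.symm)) (p.eval (κ i)))

variable (𝒢 : GateSet)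

/-- An efficient quantum algorithm with input `1^κ` (and possibly a quantum input and an oracle):
a circuit for every `κ`, whose description is produced from `1^κ` in polynomial time. Its size and
the number of its queries are thereby polynomially bounded. -/
def IsEfficient (A : ℕ → Circuit 𝒢) : Prop :=
  PolyTime (fun κ : ℕ => κ) (fun κ => List.replicate κ true) (fun κ => (A κ).encode)

/-- An efficient quantum algorithm that is given `1^κ` and a key `k ∈ 𝒦_κ`. -/
def IsEfficientKeyed (K : ℕ → Finset (List Bool)) (Q : ∀ κ, K κ → Circuit 𝒢) : Prop :=
  PolyTime (ι := Σ κ, K κ) (fun i => i.1) (fun i => encNat i.1 ++ (i.2 : List Bool))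
    (fun i => (Q i.1 i.2).encode)

/-- `f` is negligible: it decays faster than every inverse polynomial. -/
def Negligible (f : ℕ → ℝ) : Prop :=
  Asymptotics.SuperpolynomialDecay atTop (fun κ : ℕ => (κ : ℝ)) f

/-! ### Pseudorandom families -/

variable (d : ℕ → ℕ) (K : ℕ → Finset (List Bool)) (H : ∀ κ, Subgroup (UGroup (d κ)))

/-- Homogeneous space pseudorandom unitary operators for `𝕌(ℋ)/H`, where `ℋ = ℂ^(d κ)` and the key
space is `K κ`. -/
def IsHPRU (U : ∀ κ, K κ → UGroup (d κ)) : Prop :=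
  (∃ Q : ∀ κ, K κ → Circuit 𝒢, IsEfficientKeyed 𝒢 K Q ∧
    ∀ κ (k : K κ) (ψ : EuclideanSpace ℂ (Fin (d κ))), ‖ψ‖ = 1 →
      (Q κ k).Outputs (embedVec ψ) (embedVec (applyU (U κ k) ψ))) ∧
  ∃ ν : ∀ κ, Measure (UGroup (d κ)), (∀ κ, IsHaarSampling (H κ) (ν κ)) ∧
    ∀ A : ℕ → Circuit 𝒢, IsEfficient 𝒢 A →
      Negligible fun κ =>
        |(∑ k : K κ, (A κ).acceptProb (embedOp (U κ k)) (1 : QVec 0)) / (K κ).card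
          - ∫ V, (A κ).acceptProb (embedOp V) (1 : QVec 0) ∂(ν κ)|

/-- Homogeneous space pseudorandom quantum states for `𝕌(ℋ)/H`, where `ℋ = ℂ^(d κ)` and the key
space is `K κ`. -/
def IsHPRS [∀ κ, NeZero (d κ)] (φ : ∀ κ, K κ → EuclideanSpace ℂ (Fin (d κ))) : Prop :=
  (∀ κ k, ‖φ κ k‖ = 1) ∧
  (∃ Q : ∀ κ, K κ → Circuit 𝒢, IsEfficientKeyed 𝒢 K Q ∧
    ∀ κ (k : K κ), (Q κ k).Outputs (1 : QVec 0) (embedVec (φ κ k))) ∧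
  ∃ ν : ∀ κ, Measure (UGroup (d κ)), (∀ κ, IsHaarSampling (H κ) (ν κ)) ∧
    ∀ A : ℕ → Circuit 𝒢, IsEfficient 𝒢 A →
      ∀ m : ℕ → ℕ, (∃ p : Polynomial ℕ, ∀ κ, m κ ≤ p.eval κ) →
        Negligible fun κ =>
          |(∑ k : K κ, (A κ).acceptProb (1 : Matrix (QIdx 0) (QIdx 0) ℂ)
              (copies (m κ) (embedVec (φ κ k)))) / (K κ).card
            - ∫ V, (A κ).acceptProb (1 : Matrix (QIdx 0) (QIdx 0) ℂ)
                (copies (m κ) (embedVec (applyU V (ket0 (d κ))))) ∂(ν κ)|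

end HomPR

end

open MeasureTheory ProbabilityTheory Filter

namespace HomPR

/-! ### Topology and Borel structure of homogeneous spaces. -/

section HomogeneousSpace

variable {G : Type*} [Group G]

namespace CosetSpace

/-! The same laws `ν κ` serve for both families of subgroups. Only the sampling condition mentions
the subgroup, so everything reduces to `IsHaarSampling.mono`. Let `ν` arise from a Haar-random class
in `G/H₁` and a representative map `τ`. Each class of `G/H₂` is a union of classes of `G/H₁`.
`exists_fiberKernel` picks one of these at random: from the class of `g` it takes the class of `h *
g`, with `h` Haar-random in the compact group `H₂`. Composing with `τ` gives a representative map
for `G/H₂`. By Fubini and left invariance, the kernel carries the Haar measure of `G/H₂` to that of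
`G/H₁`, so the composite has the same law `ν`. Uniqueness of the Haar measure
(`eq_map_mk_of_isHaarProb`) identifies the given measure on `G/H₁` with the projected one. -/

theorem mk_surjective (H : Subgroup G) : Function.Surjective (mk H) := Quotient.mk_surjective

theorem mk_eq_mk_of_le {H₁ H₂ : Subgroup G} (hle : H₁ ≤ H₂) {g₁ g₂ : G}
    (h : mk H₁ g₁ = mk H₁ g₂) : mk H₂ g₁ = mk H₂ g₂ := by
  obtain ⟨a, ha, rfl⟩ := mk_eq_iff.1 h
  exact mk_eq_iff.2 ⟨a, hle ha, rfl⟩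

variable [TopologicalSpace G]

theorem continuous_mk (H : Subgroup G) : Continuous (mk H) := continuous_quot_mk

section TopologicalGroup

variable [IsTopologicalGroup G]

/-- The saturation of an open set is a union of its translates by `H`. Openness is what transfers
second countability and makes products of quotient maps quotient maps. -/
theorem isOpenQuotientMap_mk (H : Subgroup G) : IsOpenQuotientMap (mk H) where
  surjective := mk_surjective H
  continuous := continuous_mk H
  isOpenMap := isOpenMap_quotient_mk'_mul (Γ := H) (T := G)

instance instSecondCountableTopology (H : Subgroup G) [SecondCountableTopology G] :
    SecondCountableTopology (CosetSpace H) :=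
  (isOpenQuotientMap_mk H).isQuotientMap.secondCountableTopology
    (isOpenQuotientMap_mk H).isOpenMap

theorem isClosed_fiber {H : Subgroup G} (hH : IsClosed (H : Set G)) (x : CosetSpace H) :
    IsClosed {g | mk H g = x} := by
  obtain ⟨y, rfl⟩ := mk_surjective H x
  have : {g | mk H g = mk H y} = (fun g => g * y⁻¹) ⁻¹' (H : Set G) := by
    ext g
    simp only [Set.mem_ofPred_eq, mk_eq_iff, Set.mem_preimage, SetLike.mem_coe]
    constructor
    · rintro ⟨h, hh, rfl⟩
      simpa using hh
    · exact fun h => ⟨_, h, by simp⟩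
  rw [this]
  exact hH.preimage (continuous_id.mul continuous_const)

theorem t1Space {H : Subgroup G} (hH : IsClosed (H : Set G)) : T1Space (CosetSpace H) where
  t1 x := (isOpenQuotientMap_mk H).isQuotientMap.isClosed_preimage.1 (isClosed_fiber hH x)

theorem continuous_translate_uncurry (H : Subgroup G) :
    Continuous fun p : CosetSpace H × G => translate H p.2 p.1 := by
  rw [← ((isOpenQuotientMap_mk H).prodMap IsOpenQuotientMap.id).continuous_comp_iff]
  exact (continuous_mk H).comp continuous_mul

/-- A map out of `G/H` is Borel measurable as soon as its lift to `G` is. -/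
theorem measurable_of_comp_mk [PolishSpace G] [MeasurableSpace G] [BorelSpace G]
    {H : Subgroup G} (hH : IsClosed (H : Set G)) {β : Type*} [MeasurableSpace β]
    {f : CosetSpace H → β} (hf : Measurable (f ∘ mk H)) : Measurable f := by
  have := t1Space hH
  intro s hs
  -- The quotient σ-algebra is the Borel one: this rests on separation of analytic sets in the
  -- Polish space `G`, and needs the quotient to be T0 and second countable.
  have key := (continuous_mk H).map_eq_borel (mk_surjective H)
  rw [BorelSpace.measurable_eq (α := CosetSpace H), ← key]
  exact hf hs

end TopologicalGroup

end CosetSpace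

/-! ### Invariant measures and the fibre kernel. -/

open HomPR.CosetSpace

variable [TopologicalSpace G] [IsTopologicalGroup G] [MeasurableSpace G] [BorelSpace G]

/-- A compact group carries a Borel probability measure that is invariant on both sides. -/
theorem exists_invariant_probabilityMeasure (G : Type*) [Group G] [TopologicalSpace G]
    [IsTopologicalGroup G] [CompactSpace G] [MeasurableSpace G] [BorelSpace G] :
    ∃ ρ : Measure G, IsProbabilityMeasure ρ ∧ ρ.IsMulLeftInvariant ∧ ρ.IsMulRightInvariant := by
  have hprob : IsProbabilityMeasure (Measure.haarMeasure (G := G) ⊤) :=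
    ⟨Measure.haarMeasure_self⟩
  refine ⟨Measure.haarMeasure ⊤, hprob, inferInstance, ⟨fun g => ?_⟩⟩
  -- A right translate of Haar measure is again a left Haar probability measure, hence equal to it
  -- by uniqueness.
  have := Measure.isProbabilityMeasure_map (μ := Measure.haarMeasure (G := G) ⊤)
    (measurable_mul_const g).aemeasurable
  exact Measure.isHaarMeasure_eq_of_isProbabilityMeasure _ _

/-- A closed subgroup `H` of a compact group carries a probability measure that is invariant under
right multiplication by elements of `H`. -/
theorem exists_invariant_probabilityMeasure_of_isClosed [CompactSpace G] {H : Subgroup G}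
    (hH : IsClosed (H : Set G)) :
    ∃ ρ : Measure G, IsProbabilityMeasure ρ ∧ (∀ᵐ h ∂ρ, h ∈ H) ∧
      ∀ h ∈ H, ρ.map (fun x => x * h) = ρ := by
  have : CompactSpace H := isCompact_iff_compactSpace.1 hH.isCompact
  obtain ⟨ρ, hρ, -, hr⟩ := exists_invariant_probabilityMeasure H
  refine ⟨ρ.map Subtype.val, Measure.isProbabilityMeasure_map measurable_subtype_coe.aemeasurable,
    (ae_map_iff measurable_subtype_coe.aemeasurable hH.measurableSet).2
      (Eventually.of_forall fun h => h.2), fun h hh => ?_⟩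
  conv_rhs => rw [← map_mul_right_eq_self ρ ⟨h, hh⟩]
  rw [Measure.map_map (measurable_mul_const h) measurable_subtype_coe,
    Measure.map_map measurable_subtype_coe (measurable_mul_const _)]
  rfl

theorem isHaarProb_map_mk (H : Subgroup G) (ρ : Measure G) [IsProbabilityMeasure ρ]
    [ρ.IsMulRightInvariant] : IsHaarProb H (ρ.map (mk H)) where
  isProbabilityMeasure := Measure.isProbabilityMeasure_map (continuous_mk H).measurable.aemeasurable
  map_translate g := by
    have hm : Measurable (translate H g) :=
      ((continuous_translate_uncurry H).comp (Continuous.prodMk_left g)).measurable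
    conv_rhs => rw [← map_mul_right_eq_self ρ g]
    rw [Measure.map_map hm (continuous_mk H).measurable,
      Measure.map_map (continuous_mk H).measurable (measurable_mul_const g)]
    rfl

variable [PolishSpace G]

theorem measurable_map_mk_mul (H : Subgroup G) (ρ : Measure G) [IsProbabilityMeasure ρ] :
    Measurable fun g => ρ.map fun h => mk H (h * g) := by
  refine Measure.measurable_of_measurable_coe _ fun s hs => ?_
  have hm (g : G) : Measurable fun h => mk H (h * g) :=
    (continuous_mk H).measurable.comp (measurable_mul_const g)
  simp_rw [Measure.map_apply (hm _) hs]
  exact measurable_measure_prodMk_right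
    ((continuous_mk H).measurable.comp measurable_mul hs)

/-- Uniqueness of the Haar measure on `G/H`. -/
theorem eq_map_mk_of_isHaarProb {H : Subgroup G} {μ : Measure (CosetSpace H)} (hμ : IsHaarProb H μ)
    (ρ : Measure G) [IsProbabilityMeasure ρ] [ρ.IsMulLeftInvariant] : μ = ρ.map (mk H) := by
  have := hμ.isProbabilityMeasure
  ext s hs
  have hT : MeasurableSet ((fun p : CosetSpace H × G => translate H p.2 p.1) ⁻¹' s) :=
    (continuous_translate_uncurry H).measurable hs
  -- Average `μ` over all translations and swap the integrals: for a fixed class of `y`, the product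
  -- `y * g` with `g` drawn from `ρ` again has law `ρ`.
  calc μ s = ∫⁻ g, μ ((fun x => (x, g)) ⁻¹'
        ((fun p : CosetSpace H × G => translate H p.2 p.1) ⁻¹' s)) ∂ρ := by
        have (g : G) : μ ((fun x => (x, g)) ⁻¹'
            ((fun p : CosetSpace H × G => translate H p.2 p.1) ⁻¹' s)) = μ s := by
          conv_rhs => rw [← hμ.map_translate g]
          rw [Measure.map_apply _ hs]
          · rfl
          · exact ((continuous_translate_uncurry H).comp (Continuous.prodMk_left g)).measurable
        simp [this]
    _ = (μ.prod ρ) ((fun p : CosetSpace H × G => translate H p.2 p.1) ⁻¹' s) :=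
        (Measure.prod_apply_symm hT).symm
    _ = ∫⁻ x, ρ (Prod.mk x ⁻¹'
        ((fun p : CosetSpace H × G => translate H p.2 p.1) ⁻¹' s)) ∂μ := Measure.prod_apply hT
    _ = ρ.map (mk H) s := by
        have (x : CosetSpace H) : ρ (Prod.mk x ⁻¹'
            ((fun p : CosetSpace H × G => translate H p.2 p.1) ⁻¹' s)) = ρ.map (mk H) s := by
          obtain ⟨y, rfl⟩ := mk_surjective H x
          conv_rhs => rw [← map_mul_left_eq_self ρ y]
          rw [Measure.map_map (continuous_mk H).measurable (measurable_const_mul y),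
            Measure.map_apply ((continuous_mk H).measurable.comp (measurable_const_mul y)) hs]
          rfl
        simp [this]

variable [CompactSpace G]

/-- The Markov kernel that sends a class of `G/H₂` to a random class of `G/H₁` contained in it,
disintegrating the Haar measure on `G/H₁` over the Haar measure on `G/H₂`. -/
theorem exists_fiberKernel {H₁ H₂ : Subgroup G} (hH₂ : IsClosed (H₂ : Set G)) (hle : H₁ ≤ H₂)
    (ρ : Measure G) [IsProbabilityMeasure ρ] [ρ.IsMulLeftInvariant] :
    ∃ κ : Kernel (CosetSpace H₂) (CosetSpace H₁), IsMarkovKernel κ ∧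
      (∀ x, ∀ᵐ y ∂(κ x), ∀ g, mk H₁ g = y → mk H₂ g = x) ∧
      (ρ.map (mk H₂)).bind κ = ρ.map (mk H₁) := by
  obtain ⟨σ, hσ, hmem, hinv⟩ := exists_invariant_probabilityMeasure_of_isClosed hH₂
  have hm (g : G) : Measurable fun h => mk H₁ (h * g) :=
    (continuous_mk H₁).measurable.comp (measurable_mul_const g)
  let f : CosetSpace H₂ → Measure (CosetSpace H₁) :=
    -- Changing the representative multiplies the random element on the right by an element of `H₂`,
    -- which the right invariance of `σ` absorbs.
    Quotient.lift (fun g => σ.map fun h => mk H₁ (h * g)) fun a b hab => by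
      obtain ⟨h, hh, rfl⟩ := mk_eq_iff.1 (Quotient.sound hab : mk H₂ a = mk H₂ b)
      conv_rhs => rw [← hinv h hh]
      rw [Measure.map_map (hm b) (measurable_mul_const h)]
      simp only [Function.comp_def, mul_assoc]
  have hf (g : G) : f (mk H₂ g) = σ.map fun h => mk H₁ (h * g) := rfl
  have hfm : Measurable f := measurable_of_comp_mk hH₂ (measurable_map_mk_mul H₁ σ)
  refine ⟨⟨f, hfm⟩, ⟨fun x => ?_⟩, fun x => ?_, ?_⟩
  · obtain ⟨g, rfl⟩ := mk_surjective H₂ x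
    exact Measure.isProbabilityMeasure_map (hm g).aemeasurable
  · obtain ⟨g, rfl⟩ := mk_surjective H₂ x
    -- The set is closed, because its preimage in `G` is the `H₂`-class of `g`.
    have hfib : MeasurableSet {y : CosetSpace H₁ | ∀ a, mk H₁ a = y → mk H₂ a = mk H₂ g} := by
      refine ((isOpenQuotientMap_mk H₁).isQuotientMap.isClosed_preimage.1 ?_).measurableSet
      convert isClosed_fiber hH₂ (mk H₂ g) using 1
      ext b
      exact ⟨fun h => h b rfl, fun h a hab => (mk_eq_mk_of_le hle hab).trans h⟩
    change ∀ᵐ y ∂(f (mk H₂ g)), _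
    rw [hf, ae_map_iff (hm g).aemeasurable hfib]
    filter_upwards [hmem] with h hh a ha
    exact (mk_eq_mk_of_le hle ha).trans (mk_eq_iff.2 ⟨h, hh, rfl⟩)
  · ext s hs
    have hT : MeasurableSet ((fun p : G × G => mk H₁ (p.1 * p.2)) ⁻¹' s) :=
      (continuous_mk H₁).measurable.comp measurable_mul hs
    rw [Measure.bind_apply hs (Kernel.aemeasurable _),
      lintegral_map (Kernel.measurable_coe _ hs) (continuous_mk H₂).measurable]
    -- After Fubini `h` is fixed, and left invariance of `ρ` removes it.
    calc ∫⁻ g, f (mk H₂ g) s ∂ρ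
        = ∫⁻ g, σ ((fun h => (h, g)) ⁻¹' ((fun p : G × G => mk H₁ (p.1 * p.2)) ⁻¹' s)) ∂ρ :=
          lintegral_congr fun g => by rw [hf, Measure.map_apply (hm g) hs]; rfl
      _ = (σ.prod ρ) ((fun p : G × G => mk H₁ (p.1 * p.2)) ⁻¹' s) :=
          (Measure.prod_apply_symm hT).symm
      _ = ∫⁻ h, ρ (Prod.mk h ⁻¹' ((fun p : G × G => mk H₁ (p.1 * p.2)) ⁻¹' s)) ∂σ :=
          Measure.prod_apply hT
      _ = ρ.map (mk H₁) s := by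
          have (h : G) : ρ (Prod.mk h ⁻¹' ((fun p : G × G => mk H₁ (p.1 * p.2)) ⁻¹' s)) =
              ρ.map (mk H₁) s := by
            conv_rhs => rw [← map_mul_left_eq_self ρ h]
            rw [Measure.map_map (continuous_mk H₁).measurable (measurable_const_mul h),
              Measure.map_apply ((continuous_mk H₁).measurable.comp (measurable_const_mul h)) hs]
            rfl
          simp [this]

/-- Haar sampling of representatives for `G/H₁` is also one for `G/H₂` when `H₁ ≤ H₂`. -/
theorem IsHaarSampling.mono {H₁ H₂ : Subgroup G} (hH₂ : IsClosed (H₂ : Set G)) (hle : H₁ ≤ H₂)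
    {ν : Measure G} (hν : IsHaarSampling H₁ ν) : IsHaarSampling H₂ ν := by
  obtain ⟨μ, τ, hμ, hτ, rfl⟩ := hν
  obtain ⟨ρ, hρ, hl, hr⟩ := exists_invariant_probabilityMeasure G
  obtain ⟨κ, hκ, hmem, hbind⟩ := exists_fiberKernel hH₂ hle ρ
  have := hτ.isMarkovKernel
  refine ⟨ρ.map (mk H₂), τ ∘ₖ κ, isHaarProb_map_mk H₂ ρ, ⟨inferInstance, fun x => ?_⟩, ?_⟩
  · refine Kernel.ae_comp_of_ae_ae (isClosed_fiber hH₂ x).measurableSet ?_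
    filter_upwards [hmem x] with y hy
    filter_upwards [hτ.mem_class y] with g hg using hy g hg
  -- With `μ` written as the Haar measure of `G/H₂` followed by `κ`, associativity of `bind` gives
  -- the claim.
  · rw [eq_map_mk_of_isHaarProb hμ ρ, ← hbind, Measure.bind_bind (Kernel.aemeasurable _) (Kernel.aemeasurable _)]
    rfl

end HomogeneousSpace

/-! ### The unitary group is compact and Polish. -/

section UnitaryGroup

variable (d : ℕ)

/-- It is closed, and the entries of a unitary matrix lie in the closed unit disc. -/
theorem isCompact_unitaryGroup :
    IsCompact (Matrix.unitaryGroup (Fin d) ℂ : Set (Matrix (Fin d) (Fin d) ℂ)) := by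
  refine (IsCompact.matrix (isCompact_closedBall (0 : ℂ) 1)).of_isClosed_subset
    (isClosed_unitary (R := Matrix (Fin d) (Fin d) ℂ)) fun U hU i j => ?_
  simpa using entry_norm_bound_of_unitary hU i j

instance instCompactSpaceUGroup : CompactSpace (UGroup d) :=
  isCompact_iff_compactSpace.1 (isCompact_unitaryGroup d)

instance instPolishSpaceUGroup : PolishSpace (UGroup d) :=
  have : PolishSpace (Matrix (Fin d) (Fin d) ℂ) :=
    inferInstanceAs (PolishSpace (Fin d → Fin d → ℂ))
  (isCompact_unitaryGroup d).isClosed.polishSpace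

end UnitaryGroup

end HomPR

theorem lemma2 (𝒢 : HomPR.GateSet) (d : ℕ → ℕ) [∀ κ, NeZero (d κ)]
    (K : ℕ → Finset (List Bool)) (hK : ∀ κ, (K κ).Nonempty)
    (H₁ H₂ : ∀ κ, Subgroup (HomPR.UGroup (d κ)))
    (hH₁ : ∀ κ, IsClosed (H₁ κ : Set (HomPR.UGroup (d κ))))
    (hH₂ : ∀ κ, IsClosed (H₂ κ : Set (HomPR.UGroup (d κ))))
    (hle : ∀ κ, H₁ κ ≤ H₂ κ) :
    (∀ U : ∀ κ, K κ → HomPR.UGroup (d κ), HomPR.IsHPRU 𝒢 d K H₁ U → HomPR.IsHPRU 𝒢 d K H₂ U) ∧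
    (∀ φ : ∀ κ, K κ → EuclideanSpace ℂ (Fin (d κ)),
      HomPR.IsHPRS 𝒢 d K H₁ φ → HomPR.IsHPRS 𝒢 d K H₂ φ) := by
  refine ⟨fun U hU => ⟨hU.1, ?_⟩, fun φ hφ => ⟨hφ.1, hφ.2.1, ?_⟩⟩
  · obtain ⟨ν, hν, hA⟩ := hU.2
    exact ⟨ν, fun κ => (hν κ).mono (hH₂ κ) (hle κ), hA⟩
  · obtain ⟨ν, hν, hA⟩ := hφ.2.2
    exact ⟨ν, fun κ => (hν κ).mono (hH₂ κ) (hle κ), hA⟩
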